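/- **Setting.** Let $n\ge 1$ and consider $\min_{x\in Q}\{F(x)=f(x)+\psi(x)\}$, $Q=\operatorname{dom}\psi$, where $f:\mathbb R^n\to\mathbb R$ is twice continuously differentiable (possibly non-convex) with $\|\nabla^2 f(y)-\nabla^2 f(x)\|\le L\|y-x\|$ for all $x,y\in\mathbb R^n$ (spectral norm, $L\ge 0$), $\psi:\mathbb R^n\to\mathbb R\cup\{+\infty\}$ is proper, closed and convex, and $F^\star=\inf_Q F>-\infty$. Let $x_0\in Q$, $\tau_0>0$, $\varepsilon>0$. **Method (Zero-Order CNM, with parameter $m\ge1$).** Start with $k=0$. At outer iteration $k$, for $\ell=0,1,2,\dots$ put $$\sigma=2^4\left(\tfrac23\right)^{1/3}(2^\ell\tau_k)\,m,\qquad h=\Big[\frac{3^4\sigma^{3/2}\varepsilon^{3/2}}{2^{14}\cdot192\,n^3(2^\ell\tau_k)^3}\Big]^{1/3},\qquad h_g=\frac1{3^{1/3}}\Big[\frac{\varepsilon m}{\sigma n^{1/2}}\Big]^{1/2},$$ compute $B=\frac12(A+A^\top)$ with $$A^{(i,j)}=\frac{f(x_k+he_i+he_j)-f(x_k+he_i)-f(x_k+he_j)+f(x_k)}{h^2},$$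 and run the inner procedure from $x_{k,\ell}(0)=x_k$: for $t=0,\dots,m-1$, with $y=x_{k,\ell}(t)$, compute $g^{(i)}=\frac{f(y+h_ge_i)-f(y-h_ge_i)}{2h_g}$, and take as $y^+=x_{k,\ell}(t+1)$ any point such that, for the model $M(z)=f(y)+\langle g,z-y\rangle+\frac12\langle B(z-y),z-y\rangle+\frac\sigma6\|z-y\|^3$, one has $$M(y^+)+\psi(y^+)\le F(y),\qquad \|\nabla M(y^+)+\psi'(y^+)\|\le\tfrac\sigma4\|y^+-y\|^2$$ for some $\psi'(y^+)\in\partial\psi(y^+)$. If $F(x_k)-F(y^+)\ge\frac{\varepsilon^{3/2}}{384\,\sigma^{1/2}}(t+1)$, the inner procedure continues; otherwise it halts and is restarted from $x_k$ with $\ell+1$. If all $m$ inner steps pass this test for $\ell=\ell_k$, set $x_{k+1}=x_{k,\ell_k}(m)$, $\tau_{k+1}=\max\{\tau_0,2^{\ell_k-1}\tau_k\}$ and go to outer iteration $k+1$. Every evaluation of $f$ made in these computations and tests is counted. **Result.** Take $m:=n$. There is an absolute constant $C>0$ such that, for all data as above, every run of the method produces an iterate $\bar x=x_{k,\ell}(t)$,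 $t\ge 1$, with $$\|\nabla f(\bar x)+\psi'(\bar x)\|\le\varepsilon$$ (for the subgradient $\psi'(\bar x)\in\partial\psi(\bar x)$ obtained with it) after at most $$C\Big(n^{3/2}\,\max\{\tau_0,L\}^{1/2}\,(F(x_0)-F^\star)\,\varepsilon^{-3/2}+n^2\Big(1+\log_2\frac{\max\{\tau_0,L\}}{\tau_0}\Big)\Big)$$ evaluations of $f$. In particular, whenever $n\varepsilon^3\le1$, the number of evaluations is at most $$C\Big(\max\{\tau_0,L\}^{1/2}(F(x_0)-F^\star)+1+\log_2\frac{\max\{\tau_0,L\}}{\tau_0}\Big)\,n^{3/2}\varepsilon^{-3/2},$$ that is, $\mathcal O(n^{3/2}\varepsilon^{-3/2})$ with a constant depending only on $\tau_0$, $L$ and $F(x_0)-F^\star$. -/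

import Mathlib

namespace ZeroOrderCNM

noncomputable section

/-- Euclidean space `ℝⁿ`. -/
abbrev E (n : ℕ) : Type := EuclideanSpace ℝ (Fin n)

/-! ### The composite problem `min F`, `F = f + ψ` -/

/-- The effective domain `Q = dom ψ` of a function that never takes the value `-∞`. -/
def effDom {n : ℕ} (ψ : E n → EReal) : Set (E n) := {x | ψ x ≠ ⊤}

/-- `ψ : ℝⁿ → ℝ ∪ {+∞}` is proper, closed (lower semicontinuous) and convex (convex epigraph). -/
structure ProperClosedConvex {n : ℕ} (ψ : E n → EReal) : Prop where
  ne_bot : ∀ x, ψ x ≠ ⊥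
  exists_ne_top : ∃ x, ψ x ≠ ⊤
  closed : LowerSemicontinuous ψ
  convex : Convex ℝ {p : E n × ℝ | ψ p.1 ≤ (p.2 : EReal)}

/-- The convex subdifferential `∂ψ(x)` (empty outside the effective domain). -/
def subdiff {n : ℕ} (ψ : E n → EReal) (x : E n) : Set (E n) :=
  {v | x ∈ effDom ψ ∧ ∀ y, ψ x + ((inner ℝ v (y - x) : ℝ) : EReal) ≤ ψ y}

/-- The objective `F = f + ψ`. -/
def obj {n : ℕ} (f : E n → ℝ) (ψ : E n → EReal) (x : E n) : EReal := (f x : EReal) + ψ x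

/-- The optimal value `F⋆ = inf_{x ∈ Q} F(x)`. -/
def optValue {n : ℕ} (f : E n → ℝ) (ψ : E n → EReal) : EReal := ⨅ x ∈ effDom ψ, obj f ψ x

/-- The Hessian of `f`, as a linear operator; its operator norm is the spectral norm. -/
def hess {n : ℕ} (f : E n → ℝ) (x : E n) : E n →L[ℝ] E n := fderiv ℝ (gradient f) x

/-! ### Finite differences, with the points at which they evaluate `f` -/

/-- The standard basis vector `eᵢ`. -/
def e {n : ℕ} (i : Fin n) : E n := EuclideanSpace.single i 1

/-- Central finite difference approximation of the gradient. -/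
def fdGrad {n : ℕ} (f : E n → ℝ) (x : E n) (h : ℝ) : E n :=
  WithLp.toLp 2 fun i => (f (x + h • e i) - f (x - h • e i)) / (2 * h)

/-- The evaluation points of `fdGrad f x h`, one for each occurrence of `f`. -/
def gradQueries {n : ℕ} (x : E n) (h : ℝ) : List (E n) :=
  (List.finRange n).flatMap fun i => [x + h • e i, x - h • e i]

/-- Forward second differences. -/
def fdHessAux {n : ℕ} (f : E n → ℝ) (x : E n) (h : ℝ) : Matrix (Fin n) (Fin n) ℝ :=
  Matrix.of fun i j =>
    (f (x + h • e i + h • e j) - f (x + h • e i) - f (x + h • e j) + f x) / h ^ 2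

/-- Finite difference approximation `(A + Aᵀ) / 2` of the Hessian. -/
def fdHess {n : ℕ} (f : E n → ℝ) (x : E n) (h : ℝ) : Matrix (Fin n) (Fin n) ℝ :=
  (1 / 2 : ℝ) • (fdHessAux f x h + (fdHessAux f x h).transpose)

/-- The evaluation points of `fdHess f x h`: the point `x` once, and three further points for
every entry of the matrix (repetitions are counted). -/
def hessQueries {n : ℕ} (x : E n) (h : ℝ) : List (E n) :=
  x :: (List.finRange n).flatMap fun i => (List.finRange n).flatMap fun j =>
    [x + h • e i + h • e j, x + h • e i, x + h • e j]

/-! ### The inexact cubic step -/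

/-- The cubically regularized model
`c + ⟨g, y - x⟩ + ⟨B (y - x), y - x⟩ / 2 + σ ‖y - x‖³ / 6`, where `c = f(x)`. -/
def model {n : ℕ} (c : ℝ) (g : E n) (B : Matrix (Fin n) (Fin n) ℝ) (σ : ℝ) (x y : E n) : ℝ :=
  c + inner ℝ g (y - x) + (1 / 2) * inner ℝ (Matrix.toEuclideanCLM (𝕜 := ℝ) B (y - x)) (y - x)
    + σ / 6 * ‖y - x‖ ^ 3

/-- `x'` is an admissible inexact minimizer of the model around `x` plus `ψ`, and `v` is the
subgradient of `ψ` at `x'` that certifies it. -/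
structure InexactStep {n : ℕ} (f : E n → ℝ) (ψ : E n → EReal) (g : E n)
    (B : Matrix (Fin n) (Fin n) ℝ) (σ : ℝ) (x x' v : E n) : Prop where
  decrease : (model (f x) g B σ x x' : EReal) + ψ x' ≤ obj f ψ x
  subgrad : v ∈ subdiff ψ x'
  stationary : ‖gradient (model (f x) g B σ x) x' + v‖ ≤ σ / 4 * ‖x' - x‖ ^ 2

/-! ### Parameters of the method -/

/-- `σ_{k,ℓ} = 2⁴ (2/3)^{1/3} (2^ℓ τ_k) m`. -/
def sigma (m : ℕ) (τ : ℝ) (l : ℕ) : ℝ :=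
  2 ^ 4 * (2 / 3 : ℝ) ^ (1 / 3 : ℝ) * (2 ^ l * τ) * m

/-- The finite difference parameter `h_{k,ℓ}` for the Hessian. -/
def stepHess (n m : ℕ) (ε τ : ℝ) (l : ℕ) : ℝ :=
  ((3 ^ 4 * sigma m τ l ^ (3 / 2 : ℝ) * ε ^ (3 / 2 : ℝ)) /
    (2 ^ 14 * 192 * (n : ℝ) ^ 3 * (2 ^ l * τ) ^ 3)) ^ (1 / 3 : ℝ)

/-- The finite difference parameter `h_g` for the gradients. -/
def stepGrad (n m : ℕ) (ε σ : ℝ) : ℝ :=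
  1 / (3 : ℝ) ^ (1 / 3 : ℝ) * ((ε * m) / (σ * (n : ℝ) ^ (1 / 2 : ℝ))) ^ (1 / 2 : ℝ)

/-! ### The method as a transition system -/

/-- Where the method stands.  In all phases `x` is the outer iterate `x_k`, `τ` is `τ_k`, and `l` is
the index `ℓ` of the adaptive search. -/
inductive Phase (n : ℕ) : Type
  /-- the Hessian approximation for `(k, ℓ)` has to be computed -/
  | hessian (x : E n) (τ : ℝ) (l : ℕ)
  /-- the inner procedure runs with the matrix `B` and has the inner iterate `y = x_{k,ℓ}(t)` -/
  | cubic (x : E n) (τ : ℝ) (l : ℕ) (B : Matrix (Fin n) (Fin n) ℝ) (t : ℕ) (y : E n)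
  /-- the inner iterate `y = x_{k,ℓ}(t+1)` has just been computed, with the subgradient
  `v ∈ ∂ψ(y)`, and the progress test comes next -/
  | check (x : E n) (τ : ℝ) (l : ℕ) (B : Matrix (Fin n) (Fin n) ℝ) (t : ℕ) (y v : E n)

/-- A configuration: the phase, and the log of all points at which `f` has been evaluated. -/
structure Config (n : ℕ) : Type where
  phase : Phase n
  log : List (E n)

/-- The number of evaluations of `f` performed so far (with repetitions). -/
def Config.evals {n : ℕ} (c : Config n) : ℕ := c.log.length

/-- One step of the zeroth-order cubic Newton method with lazy Hessians (`m` inner steps for each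
Hessian approximation).  The inexact solutions of the subproblems are arbitrary admissible ones. -/
inductive Step {n : ℕ} (f : E n → ℝ) (ψ : E n → EReal) (m : ℕ) (ε τ₀ : ℝ) :
    Config n → Config n → Prop
  /-- compute `B_{k,ℓ}` and enter the inner procedure at `x_{k,ℓ}(0) = x_k` -/
  | approxHess (x : E n) (τ : ℝ) (l : ℕ) (q : List (E n)) :
      Step f ψ m ε τ₀ ⟨.hessian x τ l, q⟩
        ⟨.cubic x τ l (fdHess f x (stepHess n m ε τ l)) 0 x,
          q ++ hessQueries x (stepHess n m ε τ l)⟩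
  /-- all `m` inner steps have been made: next outer iteration -/
  | success (x : E n) (τ : ℝ) (l : ℕ) (B : Matrix (Fin n) (Fin n) ℝ) (y : E n)
      (q : List (E n)) :
      Step f ψ m ε τ₀ ⟨.cubic x τ l B m y, q⟩
        ⟨.hessian y (max τ₀ ((2 : ℝ) ^ ((l : ℤ) - 1) * τ)) 0, q⟩
  /-- approximate the gradient at `y = x_{k,ℓ}(t)` and make an inexact cubic step to `y'` -/
  | newton (x : E n) (τ : ℝ) (l : ℕ) (B : Matrix (Fin n) (Fin n) ℝ) (t : ℕ) (y y' v : E n)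
      (q : List (E n)) (ht : t ≠ m)
      (hstep : InexactStep f ψ (fdGrad f y (stepGrad n m ε (sigma m τ l))) B (sigma m τ l) y y' v) :
      Step f ψ m ε τ₀ ⟨.cubic x τ l B t y, q⟩
        ⟨.check x τ l B t y' v, q ++ gradQueries y (stepGrad n m ε (sigma m τ l))⟩
  /-- the progress test succeeds: continue the inner procedure -/
  | accept (x : E n) (τ : ℝ) (l : ℕ) (B : Matrix (Fin n) (Fin n) ℝ) (t : ℕ) (y v : E n)
      (q : List (E n))
      (htest : ((ε ^ (3 / 2 : ℝ) / (384 * sigma m τ l ^ (1 / 2 : ℝ)) * (t + 1) : ℝ) : EReal)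
        ≤ obj f ψ x - obj f ψ y) :
      Step f ψ m ε τ₀ ⟨.check x τ l B t y v, q⟩ ⟨.cubic x τ l B (t + 1) y, q ++ [y]⟩
  /-- the progress test fails: restart from `x_k` with `ℓ + 1` -/
  | halt (x : E n) (τ : ℝ) (l : ℕ) (B : Matrix (Fin n) (Fin n) ℝ) (t : ℕ) (y v : E n)
      (q : List (E n))
      (htest : ¬ ((ε ^ (3 / 2 : ℝ) / (384 * sigma m τ l ^ (1 / 2 : ℝ)) * (t + 1) : ℝ) : EReal)
        ≤ obj f ψ x - obj f ψ y) :
      Step f ψ m ε τ₀ ⟨.check x τ l B t y v, q⟩ ⟨.hessian x τ (l + 1), q ++ [y]⟩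

/-- A run of the method from `x₀`.  The method has no stopping test, so runs are infinite. -/
def IsRun {n : ℕ} (f : E n → ℝ) (ψ : E n → EReal) (m : ℕ) (ε τ₀ : ℝ) (x₀ : E n)
    (r : ℕ → Config n) : Prop :=
  r 0 = ⟨.hessian x₀ τ₀ 0, []⟩ ∧ ∀ i, Step f ψ m ε τ₀ (r i) (r (i + 1))

/-- The configuration has just produced an iterate `y` which, with the subgradient `v ∈ ∂ψ(y)`
delivered with it, satisfies `‖∇f(y) + v‖ ≤ ε`. -/
def Found {n : ℕ} (f : E n → ℝ) (ψ : E n → EReal) (ε : ℝ) (c : Config n) : Prop :=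
  ∃ (x : E n) (τ : ℝ) (l : ℕ) (B : Matrix (Fin n) (Fin n) ℝ) (t : ℕ) (y v : E n),
    c.phase = .check x τ l B t y v ∧ v ∈ subdiff ψ y ∧ ‖gradient f y + v‖ ≤ ε

end

end ZeroOrderCNM

namespace ZeroOrderCNM

/-! ### Taylor estimates -/

/-! Write `ε = a²`, `σ = b²`, `M = max τ₀ L`, and measure lengths in units of `a / b`. The proof
balances the decrease of the objective against two sources of error: finite differences, and the
Hessian frozen at `x_k`.

Suppose `L ≤ 2^ℓ τ_k`. The choice of `h` and `h_g` keeps the finite difference errors at small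
multiples of `a b` and `a²`. A step of normalized length `ρ` that does not reach an approximate
stationary point then decreases `F` by at least `a³/b · (1/384 + ρ³/20 - 100 w³)`, where `w`
measures the drift of the Hessian since `x_k` (`InexactStep.progress`). The drift is at most `1/(13
m)` times the sum of the earlier step lengths, because `σ ≥ 13 L m`. By Hölder's inequality the
accumulated penalty is paid for by the terms `ρ³/20` during all `m` steps (`InnerProgress.succ`,
`InnerProgress.le`). So the progress test cannot fail, and a failed test forces `2^ℓ τ_k < L`; hence
`2^ℓ τ_k ≤ 2 M` throughout.

Each completed outer iteration therefore decreases `F` by at least `outerDecrease`, which bounds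
their number `K`. A restart doubles `2^ℓ τ_k` and a success at most halves it, so the number of
restarts satisfies `J ≤ K + 1 + log₂ (M / τ₀)`. For `m = n` a pass costs at most `7 n²` evaluations
(`Inv.step`, `Inv.evals_le`). Since the evaluations of an infinite run are unbounded
(`le_two_mul_evals`), a stationary point must be found. -/

lemma norm_le_pow_of_norm_deriv_le {V : Type*} [NormedAddCommGroup V] [NormedSpace ℝ V]
    {g g' : ℝ → V} {K : ℝ} {k : ℕ} (hg : ∀ t, HasDerivAt g (g' t) t) (h0 : g 0 = 0)
    (hb : ∀ t, 0 ≤ t → ‖g' t‖ ≤ K * ((k + 1) * t ^ k)) {t : ℝ} (ht : 0 ≤ t) :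
    ‖g t‖ ≤ K * t ^ (k + 1) := by
  have hB : ∀ x : ℝ, HasDerivAt (fun s : ℝ => K * s ^ (k + 1)) (K * ((k + 1) * x ^ k)) x := by
    intro x
    have := (hasDerivAt_pow (k + 1) x).const_mul K
    simpa using this
  refine image_norm_le_of_norm_deriv_right_le_deriv_boundary (a := 0) (b := t)
    (fun x _ => (hg x).continuousAt.continuousWithinAt) (fun x _ => (hg x).hasDerivWithinAt)
    (by simp [h0]) hB (fun x hx => hb x hx.1) ⟨ht, le_rfl⟩

section Taylor

variable {n : ℕ} {f : E n → ℝ} {L : ℝ}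

lemma hasFDerivAt_gradient (hf : ContDiff ℝ 2 f) (x : E n) :
    HasFDerivAt (gradient f) (hess f x) x := by
  have h1 : ContDiff ℝ 1 (fderiv ℝ f) := hf.fderiv_right (by norm_num)
  have h2 : DifferentiableAt ℝ (gradient f) x :=
    (InnerProductSpace.toDual ℝ (E n)).symm.differentiableAt.comp x
      ((h1.differentiable one_ne_zero) x)
  exact h2.hasFDerivAt

lemma hasGradientAt_of_contDiff (hf : ContDiff ℝ 2 f) (x : E n) :
    HasGradientAt f (gradient f x) x :=
  (hf.differentiable two_ne_zero x).hasGradientAt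

/-- Links the operator `hess` to the second derivative, so that Schwarz's theorem gives the symmetry
of `hess`. -/
lemma inner_hess_apply (hf : ContDiff ℝ 2 f) (x u v : E n) :
    inner ℝ (hess f x u) v = fderiv ℝ (fderiv ℝ f) x u v := by
  have h1 : ContDiff ℝ 1 (fderiv ℝ f) := hf.fderiv_right (by norm_num)
  have h2 : HasFDerivAt (fun z => inner ℝ (gradient f z) v)
      ((innerSL ℝ v).comp (hess f x)) x := by
    have := (innerSL ℝ v).hasFDerivAt.comp x (hasFDerivAt_gradient hf x)
    refine this.congr_of_eventuallyEq (Filter.Eventually.of_forall fun z => ?_)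
    simp
  have h3 : HasFDerivAt (fun z => fderiv ℝ f z v)
      ((ContinuousLinearMap.apply ℝ ℝ v).comp (fderiv ℝ (fderiv ℝ f) x)) x :=
    (ContinuousLinearMap.apply ℝ ℝ v).hasFDerivAt.comp x
      ((h1.differentiable one_ne_zero) x).hasFDerivAt
  have h4 : (fun z => inner ℝ (gradient f z) v) = fun z => fderiv ℝ f z v := by
    funext z
    rw [gradient, InnerProductSpace.toDual_symm_apply]
  rw [h4] at h2
  have h5 := congrArg (fun T : E n →L[ℝ] ℝ => T u) (h2.unique h3)
  simpa [real_inner_comm] using h5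

lemma inner_hess_symm (hf : ContDiff ℝ 2 f) (x u v : E n) :
    inner ℝ (hess f x u) v = inner ℝ (hess f x v) u := by
  rw [inner_hess_apply hf, inner_hess_apply hf]
  exact (hf.contDiffAt.isSymmSndFDerivAt (by simp)).eq u v

lemma hasDerivAt_line (x d : E n) (t : ℝ) : HasDerivAt (fun s : ℝ => x + s • d) d t := by
  simpa using ((hasDerivAt_id t).smul_const d).const_add x

lemma norm_gradient_taylor_line_le (hf : ContDiff ℝ 2 f)
    (hL : ∀ x y, ‖hess f y - hess f x‖ ≤ L * ‖y - x‖) (x d : E n) {t : ℝ} (ht : 0 ≤ t) :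
    ‖gradient f (x + t • d) - gradient f x - t • hess f x d‖ ≤ L / 2 * ‖d‖ ^ 2 * t ^ 2 := by
  refine norm_le_pow_of_norm_deriv_le (k := 1)
    (g := fun t => gradient f (x + t • d) - gradient f x - t • hess f x d)
    (g' := fun t => hess f (x + t • d) d - hess f x d) (fun s => ?_) (by simp) (fun s hs => ?_) ht
  · have h1 := (hasFDerivAt_gradient hf (x + s • d)).comp_hasDerivAt s (hasDerivAt_line x d s)
    have h2 := (hasDerivAt_id s).smul_const (hess f x d)
    refine ((h1.sub_const (gradient f x)).sub h2).congr_deriv ?_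
    simp
  · rw [← sub_apply]
    refine (ContinuousLinearMap.le_opNorm _ _).trans ?_
    have := hL x (x + s • d)
    rw [add_sub_cancel_left, norm_smul, Real.norm_of_nonneg hs] at this
    refine (mul_le_mul_of_nonneg_right this (norm_nonneg d)).trans (le_of_eq ?_)
    norm_num
    ring

lemma norm_gradient_taylor_le (hf : ContDiff ℝ 2 f)
    (hL : ∀ x y, ‖hess f y - hess f x‖ ≤ L * ‖y - x‖) (x d : E n) :
    ‖gradient f (x + d) - gradient f x - hess f x d‖ ≤ L / 2 * ‖d‖ ^ 2 := by
  simpa using norm_gradient_taylor_line_le hf hL x d zero_le_one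

lemma abs_taylor_le (hf : ContDiff ℝ 2 f)
    (hL : ∀ x y, ‖hess f y - hess f x‖ ≤ L * ‖y - x‖) (x d : E n) :
    |f (x + d) - f x - inner ℝ (gradient f x) d - 1 / 2 * inner ℝ (hess f x d) d|
      ≤ L / 6 * ‖d‖ ^ 3 := by
  have key := norm_le_pow_of_norm_deriv_le (k := 2) (K := L / 6 * ‖d‖ ^ 3)
    (g := fun t : ℝ => f (x + t • d) - f x - t * inner ℝ (gradient f x) d
      - t ^ 2 * (1 / 2 * inner ℝ (hess f x d) d))
    (g' := fun t => inner ℝ (gradient f (x + t • d) - gradient f x - t • hess f x d) d)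
    (fun s => ?_) (by simp) (fun s hs => ?_) zero_le_one
  · simpa using key
  · have h1 := (hasGradientAt_of_contDiff hf (x + s • d)).hasFDerivAt.comp_hasDerivAt s
      (hasDerivAt_line x d s)
    have h2 := (hasDerivAt_id s).mul_const (inner ℝ (gradient f x) d)
    have h3 := (hasDerivAt_pow 2 s).mul_const (1 / 2 * inner ℝ (hess f x d) d)
    refine (((h1.sub_const (f x)).sub h2).sub h3).congr_deriv ?_
    simp [inner_sub_left, inner_smul_left]
    ring
  · refine (norm_inner_le_norm _ _).trans ?_
    refine (mul_le_mul_of_nonneg_right (norm_gradient_taylor_line_le hf hL x d hs)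
      (norm_nonneg d)).trans (le_of_eq ?_)
    norm_num
    ring

end Taylor

/-! ### Finite difference errors -/

lemma norm_e {n : ℕ} (i : Fin n) : ‖(e i : E n)‖ = 1 := by simp [e]

lemma inner_e_right {n : ℕ} (v : E n) (i : Fin n) : inner ℝ v (e i) = v i := by
  simp [e, EuclideanSpace.inner_single_right]

lemma norm_le_sqrt_mul_of_abs_le {n : ℕ} {v : E n} {c : ℝ} (hc : 0 ≤ c) (h : ∀ i, |v i| ≤ c) :
    ‖v‖ ≤ (n : ℝ) ^ (1 / 2 : ℝ) * c := by
  rw [← Real.sqrt_eq_rpow]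
  apply le_of_sq_le_sq _ (by positivity)
  rw [EuclideanSpace.real_norm_sq_eq, mul_pow, Real.sq_sqrt (Nat.cast_nonneg n)]
  calc ∑ i, v i ^ 2 ≤ ∑ _i : Fin n, c ^ 2 :=
        Finset.sum_le_sum fun i _ => sq_le_sq' (abs_le.1 (h i)).1 (abs_le.1 (h i)).2
    _ = n * c ^ 2 := by simp

/-- In a central difference the quadratic Taylor terms cancel, leaving only the two cubic remainders
in each coordinate. -/
lemma norm_fdGrad_sub_le {n : ℕ} {f : E n → ℝ} {L : ℝ} (hf : ContDiff ℝ 2 f)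
    (hL : ∀ x y, ‖hess f y - hess f x‖ ≤ L * ‖y - x‖) (hL0 : 0 ≤ L) (x : E n) {h : ℝ}
    (hh : 0 < h) :
    ‖fdGrad f x h - gradient f x‖ ≤ (n : ℝ) ^ (1 / 2 : ℝ) * (L / 6 * h ^ 2) := by
  refine norm_le_sqrt_mul_of_abs_le (by positivity) fun i => ?_
  have h1 := abs_taylor_le hf hL x (h • e i)
  have h2 := abs_taylor_le hf hL x (-(h • e i))
  simp only [map_neg, inner_neg_left, inner_neg_right, norm_neg, norm_smul, norm_e,
    Real.norm_of_nonneg hh.le, inner_smul_right, inner_e_right, mul_one, ← sub_eq_add_neg] at h1 h2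
  simp only [fdGrad, PiLp.sub_apply]
  rw [abs_le] at *
  have h3 : (f (x + h • e i) - f (x - h • e i)) / (2 * h) - (gradient f x) i
      = (f (x + h • e i) - f (x - h • e i) - 2 * h * (gradient f x) i) / (2 * h) := by
    field_simp
  rw [h3, div_le_iff₀ (by positivity), le_div_iff₀ (by positivity)]
  constructor <;> nlinarith

/-- Three Taylor expansions at `x` leave remainders `L/6 · ((2h)³ + h³ + h³)`; division by `h²`
gives `5/3 · L h`. -/
lemma abs_fdHessAux_sub_le {n : ℕ} {f : E n → ℝ} {L : ℝ} (hf : ContDiff ℝ 2 f)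
    (hL : ∀ x y, ‖hess f y - hess f x‖ ≤ L * ‖y - x‖) (hL0 : 0 ≤ L) (x : E n) {h : ℝ}
    (hh : 0 < h) (i j : Fin n) :
    |fdHessAux f x h i j - inner ℝ (hess f x (e j)) (e i)| ≤ 5 / 3 * (L * h) := by
  have h1 := abs_taylor_le hf hL x (h • e i)
  have h2 := abs_taylor_le hf hL x (h • e j)
  have h3 := abs_taylor_le hf hL x (h • e i + h • e j)
  have h4 : ‖(h • e i + h • e j : E n)‖ ^ 3 ≤ (2 * h) ^ 3 := by
    gcongr
    refine (norm_add_le _ _).trans ?_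
    simp only [norm_smul, norm_e, Real.norm_of_nonneg hh.le]
    linarith
  have h5 : L / 6 * ‖(h • e i + h • e j : E n)‖ ^ 3 ≤ L / 6 * (2 * h) ^ 3 := by gcongr
  have h6 := inner_hess_symm hf x (e i) (e j)
  replace h3 := h3.trans h5
  simp only [map_add, map_smul, inner_add_left, inner_add_right, inner_smul_left,
    norm_smul, norm_e, Real.norm_of_nonneg hh.le, inner_smul_right, mul_one, h6,
    ← add_assoc, conj_trivial] at h1 h2 h3
  simp only [fdHessAux, Matrix.of_apply]
  have h7 : ∀ u a : ℝ, u / h ^ 2 - a = (u - a * h ^ 2) / h ^ 2 := by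
    intro u a; field_simp
  rw [abs_le] at *
  rw [h7, div_le_iff₀ (by positivity), le_div_iff₀ (by positivity)]
  constructor <;> nlinarith

lemma abs_fdHess_sub_le {n : ℕ} {f : E n → ℝ} {L : ℝ} (hf : ContDiff ℝ 2 f)
    (hL : ∀ x y, ‖hess f y - hess f x‖ ≤ L * ‖y - x‖) (hL0 : 0 ≤ L) (x : E n) {h : ℝ}
    (hh : 0 < h) (i j : Fin n) :
    |fdHess f x h i j - inner ℝ (hess f x (e j)) (e i)| ≤ 5 / 3 * (L * h) := by
  have h1 := abs_fdHessAux_sub_le hf hL hL0 x hh i j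
  have h2 := abs_fdHessAux_sub_le hf hL hL0 x hh j i
  rw [inner_hess_symm hf] at h2
  simp only [fdHess, Matrix.smul_apply, Matrix.add_apply, Matrix.transpose_apply, smul_eq_mul]
  rw [abs_le] at *
  constructor <;> linarith

/-- Cauchy–Schwarz in each row, that is, the operator norm is at most the Frobenius norm, which
costs a factor `n`. -/
lemma norm_fdHess_sub_apply_le {n : ℕ} {f : E n → ℝ} {L : ℝ} (hf : ContDiff ℝ 2 f)
    (hL : ∀ x y, ‖hess f y - hess f x‖ ≤ L * ‖y - x‖) (hL0 : 0 ≤ L) (x : E n) {h : ℝ}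
    (hh : 0 < h) (d : E n) :
    ‖Matrix.toEuclideanCLM (𝕜 := ℝ) (fdHess f x h) d - hess f x d‖
      ≤ 5 / 3 * (n * L * h) * ‖d‖ := by
  have hd : d = ∑ j, d j • e j := by
    ext i
    simp [e, Finset.sum_apply, Pi.single_apply]
  have hcoord : ∀ i, (Matrix.toEuclideanCLM (𝕜 := ℝ) (fdHess f x h) d - hess f x d) i
      = ∑ j, (fdHess f x h i j - inner ℝ (hess f x (e j)) (e i)) * d j := by
    intro i
    have h1 : (hess f x d) i = ∑ j, inner ℝ (hess f x (e j)) (e i) * d j := by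
      conv_lhs => rw [hd]
      simp [inner_e_right, mul_comm]
    have h2 : (Matrix.toEuclideanCLM (𝕜 := ℝ) (fdHess f x h) d) i
        = ∑ j, fdHess f x h i j * d j := by
      rw [Matrix.ofLp_toEuclideanCLM]
      rfl
    rw [PiLp.sub_apply, h1, h2, ← Finset.sum_sub_distrib]
    simp [sub_mul]
  have hnd : ‖d‖ ^ 2 = ∑ j, d j ^ 2 := EuclideanSpace.real_norm_sq_eq d
  apply le_of_sq_le_sq _ (by positivity)
  rw [EuclideanSpace.real_norm_sq_eq]
  calc ∑ i, ((Matrix.toEuclideanCLM (𝕜 := ℝ) (fdHess f x h) d - hess f x d) i) ^ 2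
      ≤ ∑ _i : Fin n, (n * (5 / 3 * (L * h)) ^ 2) * ‖d‖ ^ 2 := by
        refine Finset.sum_le_sum fun i _ => ?_
        rw [hcoord, hnd]
        refine (Finset.sum_mul_sq_le_sq_mul_sq _ _ _).trans ?_
        gcongr
        calc ∑ j, (fdHess f x h i j - inner ℝ (hess f x (e j)) (e i)) ^ 2
            ≤ ∑ _j : Fin n, (5 / 3 * (L * h)) ^ 2 := Finset.sum_le_sum fun j _ =>
              sq_le_sq' (abs_le.1 (abs_fdHess_sub_le hf hL hL0 x hh i j)).1
                (abs_le.1 (abs_fdHess_sub_le hf hL hL0 x hh i j)).2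
          _ = n * (5 / 3 * (L * h)) ^ 2 := by simp
    _ = (5 / 3 * (n * L * h) * ‖d‖) ^ 2 := by
        simp
        ring

/-! ### The gradient of the model -/

lemma inner_fdHess_symm {n : ℕ} (f : E n → ℝ) (x : E n) (h : ℝ) (u v : E n) :
    inner ℝ (Matrix.toEuclideanCLM (𝕜 := ℝ) (fdHess f x h) u) v
      = inner ℝ (Matrix.toEuclideanCLM (𝕜 := ℝ) (fdHess f x h) v) u := by
  have hs : (fdHess f x h).IsSymm := by
    unfold fdHess Matrix.IsSymm
    rw [Matrix.transpose_smul, Matrix.transpose_add, Matrix.transpose_transpose, add_comm]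
  simp only [PiLp.inner_apply, Matrix.ofLp_toEuclideanCLM, Matrix.mulVec, dotProduct,
    RCLike.inner_apply, conj_trivial, Finset.mul_sum]
  rw [Finset.sum_comm]
  refine Finset.sum_congr rfl fun j _ => Finset.sum_congr rfl fun i _ => ?_
  rw [hs.apply]
  ring

/-- The symmetry of `B` makes `B (y - x)` the gradient of the quadratic term. -/
lemma gradient_model {n : ℕ} (c : ℝ) (g : E n) (B : Matrix (Fin n) (Fin n) ℝ) (σ : ℝ)
    (hB : ∀ u v : E n, inner ℝ (Matrix.toEuclideanCLM (𝕜 := ℝ) B u) v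
      = inner ℝ (Matrix.toEuclideanCLM (𝕜 := ℝ) B v) u) (x y : E n) :
    gradient (model c g B σ x) y
      = g + Matrix.toEuclideanCLM (𝕜 := ℝ) B (y - x) + (σ / 2 * ‖y - x‖) • (y - x) := by
  apply HasGradientAt.gradient
  rw [hasGradientAt_iff_hasFDerivAt]
  have h0 : HasFDerivAt (fun z : E n => z - x) (ContinuousLinearMap.id ℝ (E n)) y :=
    (hasFDerivAt_id y).sub_const x
  have h1 : HasFDerivAt (fun z : E n => inner ℝ g (z - x)) (innerSL ℝ g) y :=
    ((innerSL ℝ g).hasFDerivAt.comp y h0)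
  have h2 := ((Matrix.toEuclideanCLM (𝕜 := ℝ) B).hasFDerivAt.comp y h0).inner ℝ h0
  have h3 : HasFDerivAt (fun z : E n => ‖z - x‖ ^ 3) ((3 * ‖y - x‖) • innerSL ℝ (y - x)) y := by
    have := (hasFDerivAt_norm_rpow (y - x) (p := 3) (by norm_num)).comp y h0
    refine (this.congr_of_eventuallyEq (Filter.Eventually.of_forall fun z => ?_)).congr_fderiv ?_
    · simp only [Function.comp]
      exact_mod_cast rfl
    · norm_num
  refine (((h1.const_add c).add (h2.const_mul (1 / 2))).add (h3.const_mul (σ / 6))).congr_fderiv ?_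
  ext u
  have := hB u (y - x)
  simp [this, fderivInnerCLM_apply, inner_sub_left]
  ring

/-! ### Scalar inequalities -/

/-- The hypothesis is `‖∇f(y') + v‖ > ε` in normalized form, the conclusion the resulting decrease.
A step that misses stationarity is either long, so that the cubic term wins, or comes with so large
a drift `w` that the claimed bound is very negative. -/
lemma cubic_progress {ρ w : ℝ} (hρ : 0 ≤ ρ) (hw : 0 ≤ w)
    (h : 1 < (3 / 4 + 1 / 26) * ρ ^ 2 + 1 / 150 + ρ / 20 + w * ρ) :
    1 / 384 + ρ ^ 3 / 20 - 100 * w ^ 3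
      ≤ (1 / 6 - 1 / 78) * ρ ^ 3 - ρ / 150 - ρ ^ 2 / 40 - w * ρ ^ 2 / 2 := by
  rcases le_or_gt (3 / 5) ρ with h1 | h1
  · have h2 : w * ρ ^ 2 / 2 ≤ 100 * w ^ 3 + ρ ^ 3 / 70 := by
      -- AM-GM for `w ρ²`: with `c = 41/1000` the product is `w³ - 3 c² w ρ² + 2 c³ ρ³`, and `300 c²
      -- > 1/2`, `200 c³ < 1/70`.
      have h3 : 0 ≤ (w - 41 / 1000 * ρ) ^ 2 * (w + 41 / 500 * ρ) := by positivity
      have h4 : 0 ≤ w * ρ ^ 2 := by positivity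
      have h5 : 0 ≤ ρ ^ 3 := by positivity
      nlinarith
    have h6 : 0 ≤ (ρ - 3 / 5) * ρ ^ 2 := by
      apply mul_nonneg (by linarith) (by positivity)
    have h7 : 0 ≤ (ρ - 3 / 5) * ρ := mul_nonneg (by linarith) hρ
    nlinarith
  · have h2 : 6 / 5 * ρ ≤ 18 / 25 := by linarith
    have h3 : ρ ^ 2 ≤ 9 / 25 := by nlinarith
    have h4 : 1 < w := by
      by_contra hw1
      have : w * ρ ≤ 1 * (3 / 5) := mul_le_mul (not_lt.1 hw1) h1.le hρ zero_le_one
      nlinarith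
    have h5 : w ≤ w ^ 3 := by nlinarith [mul_pos (by linarith : (0 : ℝ) < w - 1) (by linarith : 0 < w)]
    have h6 : w * ρ ^ 2 ≤ w * (9 / 25) := by gcongr
    have h7 : 0 ≤ ρ ^ 3 := by positivity
    nlinarith

/-- Inductive step of Hölder's inequality `(∑ ρᵢ)³ ≤ t² ∑ ρᵢ³`. With `P = t p` it is convexity of
the cube, with an explicit nonnegative remainder. -/
lemma add_pow_three_le {P ρ S t : ℝ} (hP : 0 ≤ P) (hρ : 0 ≤ ρ) (ht : 0 ≤ t) (hS : 0 ≤ S)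
    (h : P ^ 3 ≤ t ^ 2 * S) : (P + ρ) ^ 3 ≤ (t + 1) ^ 2 * (S + ρ ^ 3) := by
  rcases ht.eq_or_lt with rfl | ht
  · have hP0 : P = 0 := by
      have : P ^ 3 ≤ 0 := by simpa using h
      exact pow_eq_zero_iff (three_ne_zero) |>.1 (le_antisymm this (by positivity))
    subst hP0
    nlinarith
  · obtain ⟨p, rfl⟩ : ∃ p, P = t * p := ⟨P / t, by field_simp⟩
    have hp : 0 ≤ p := nonneg_of_mul_nonneg_right hP ht
    have h1 : t * p ^ 3 ≤ S := by
      have : t ^ 2 * (t * p ^ 3) ≤ t ^ 2 * S := by linarith [h, mul_pow t p 3]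
      exact le_of_mul_le_mul_left this (by positivity)
    have h2 : (t * p + ρ) ^ 3 = (t + 1) ^ 2 * (t * p ^ 3 + ρ ^ 3)
        - t * (p - ρ) ^ 2 * ((2 * t + 1) * p + (t + 2) * ρ) := by ring
    have h3 : 0 ≤ t * (p - ρ) ^ 2 * ((2 * t + 1) * p + (t + 2) * ρ) := by positivity
    calc (t * p + ρ) ^ 3 ≤ (t + 1) ^ 2 * (t * p ^ 3 + ρ ^ 3) := by linarith
      _ ≤ _ := by gcongr

/-! ### One inexact cubic step -/

/-- The objective, as a real number (meaningful on the effective domain). -/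
def objReal {n : ℕ} (f : E n → ℝ) (ψ : E n → EReal) (x : E n) : ℝ := f x + (ψ x).toReal

lemma obj_eq_coe {n : ℕ} {f : E n → ℝ} {ψ : E n → EReal} (hψ : ∀ x, ψ x ≠ ⊥) {x : E n}
    (hx : x ∈ effDom ψ) : obj f ψ x = (objReal f ψ x : EReal) := by
  rw [obj, objReal, EReal.coe_add, EReal.coe_toReal hx (hψ x)]

lemma InexactStep.model_add_le {n : ℕ} {f : E n → ℝ} {ψ : E n → EReal} {g : E n}
    {B : Matrix (Fin n) (Fin n) ℝ} {σ : ℝ} {y y' v : E n} (hs : InexactStep f ψ g B σ y y' v)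
    (hψ : ∀ x, ψ x ≠ ⊥) (hy : y ∈ effDom ψ) :
    model (f y) g B σ y y' - f y' ≤ objReal f ψ y - objReal f ψ y' := by
  have h := hs.decrease
  rw [obj_eq_coe hψ hy, ← EReal.coe_toReal hs.subgrad.1 (hψ y'), ← EReal.coe_add,
    EReal.coe_le_coe_iff] at h
  unfold objReal at *
  linarith

lemma InexactStep.progress {n : ℕ} {f : E n → ℝ} {ψ : E n → EReal} {L a b : ℝ} {x y y' g v : E n}
    {B : Matrix (Fin n) (Fin n) ℝ} (hf : ContDiff ℝ 2 f)
    (hL : ∀ x y, ‖hess f y - hess f x‖ ≤ L * ‖y - x‖) (hL0 : 0 ≤ L) (hψ : ∀ x, ψ x ≠ ⊥)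
    (ha : 0 < a) (hb : 0 < b) (hLb : 13 * L ≤ b ^ 2)
    (hB : ∀ u v : E n, inner ℝ (Matrix.toEuclideanCLM (𝕜 := ℝ) B u) v
      = inner ℝ (Matrix.toEuclideanCLM (𝕜 := ℝ) B v) u)
    (hBx : ∀ d, ‖Matrix.toEuclideanCLM (𝕜 := ℝ) B d - hess f x d‖ ≤ a * b / 20 * ‖d‖)
    (hg : ‖g - gradient f y‖ ≤ a ^ 2 / 150)
    (hs : InexactStep f ψ g B (b ^ 2) y y' v) (hy : y ∈ effDom ψ)
    (hv : a ^ 2 < ‖gradient f y' + v‖) :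
    a ^ 3 / b * (1 / 384 + (‖y' - y‖ * b / a) ^ 3 / 20 - 100 * (L * ‖y - x‖ / (a * b)) ^ 3)
      ≤ objReal f ψ y - objReal f ψ y' := by
  obtain ⟨d, rfl⟩ : ∃ d, y' = y + d := ⟨y' - y, by abel⟩
  obtain ⟨ρ, hρ⟩ : ∃ ρ, ρ = ‖d‖ * b / a := ⟨_, rfl⟩
  obtain ⟨w, hw⟩ : ∃ w, w = L * ‖y - x‖ / (a * b) := ⟨_, rfl⟩
  rw [add_sub_cancel_left, ← hρ, ← hw]
  have hρ0 : 0 ≤ ρ := by rw [hρ]; positivity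
  have hw0 : 0 ≤ w := by rw [hw]; positivity
  have hr : ‖d‖ = ρ * a / b := by rw [hρ]; field_simp
  have hR : L * ‖y - x‖ = w * (a * b) := by rw [hw]; field_simp
  have hHd : ‖hess f y d - hess f x d‖ ≤ w * (a * b) * ‖d‖ := by
    rw [← sub_apply, ← hR]
    exact (ContinuousLinearMap.le_opNorm _ _).trans
      (mul_le_mul_of_nonneg_right (hL x y) (norm_nonneg d))
  have hLr : L ≤ b ^ 2 / 13 := by linarith
  have hstat := hs.stationary
  rw [gradient_model _ _ _ _ hB, add_sub_cancel_left] at hstat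
  have hcond : 1 < (3 / 4 + 1 / 26) * ρ ^ 2 + 1 / 150 + ρ / 20 + w * ρ := by
    have h1 := norm_gradient_taylor_le hf hL y d
    -- The terms are: the residual of the subproblem, the Taylor remainder, the Hessian drift from
    -- `x` to `y`, the two finite difference errors, and the gradient of the cubic regularizer.
    have h2 : gradient f (y + d) + v
        = (g + Matrix.toEuclideanCLM (𝕜 := ℝ) B d + (b ^ 2 / 2 * ‖d‖) • d + v)
          + (gradient f (y + d) - gradient f y - hess f y d) + (hess f y d - hess f x d)
          - (g - gradient f y) - (Matrix.toEuclideanCLM (𝕜 := ℝ) B d - hess f x d)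
          - (b ^ 2 / 2 * ‖d‖) • d := by abel
    have h3 : ‖(b ^ 2 / 2 * ‖d‖) • d‖ = b ^ 2 / 2 * ‖d‖ ^ 2 := by
      rw [norm_smul, Real.norm_of_nonneg (by positivity)]; ring
    have h4 : ‖gradient f (y + d) + v‖ ≤ b ^ 2 / 4 * ‖d‖ ^ 2 + L / 2 * ‖d‖ ^ 2
        + w * (a * b) * ‖d‖ + a ^ 2 / 150 + a * b / 20 * ‖d‖ + b ^ 2 / 2 * ‖d‖ ^ 2 := by
      rw [h2, ← h3]
      refine (norm_sub_le _ _).trans (add_le_add ?_ le_rfl)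
      refine (norm_sub_le _ _).trans (add_le_add ?_ (hBx d))
      refine (norm_sub_le _ _).trans (add_le_add ?_ hg)
      refine (norm_add_le _ _).trans (add_le_add ?_ hHd)
      exact (norm_add_le _ _).trans (add_le_add hstat h1)
    have h5 : L / 2 * ‖d‖ ^ 2 ≤ b ^ 2 / 13 / 2 * ‖d‖ ^ 2 := by gcongr
    have h6 : b ^ 2 / 4 * ‖d‖ ^ 2 + b ^ 2 / 13 / 2 * ‖d‖ ^ 2
        + w * (a * b) * ‖d‖ + a ^ 2 / 150 + a * b / 20 * ‖d‖ + b ^ 2 / 2 * ‖d‖ ^ 2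
        = a ^ 2 * ((3 / 4 + 1 / 26) * ρ ^ 2 + 1 / 150 + ρ / 20 + w * ρ) := by
      rw [hr]; field_simp; ring
    have h7 : a ^ 2 * 1 < a ^ 2 * ((3 / 4 + 1 / 26) * ρ ^ 2 + 1 / 150 + ρ / 20 + w * ρ) := by
      rw [← h6]; linarith
    exact lt_of_mul_lt_mul_left h7 (by positivity)
  refine le_trans ?_ (hs.model_add_le hψ hy)
  have h1 := (abs_le.1 (abs_taylor_le hf hL y d)).2
  have h2 : -(a ^ 2 / 150 * ‖d‖) ≤ inner ℝ (g - gradient f y) d :=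
    (abs_le.1 ((abs_real_inner_le_norm _ _).trans
      (mul_le_mul_of_nonneg_right hg (norm_nonneg d)))).1
  have h3 : -(a * b / 20 * ‖d‖ * ‖d‖)
      ≤ inner ℝ (Matrix.toEuclideanCLM (𝕜 := ℝ) B d - hess f x d) d :=
    (abs_le.1 ((abs_real_inner_le_norm _ _).trans
      (mul_le_mul_of_nonneg_right (hBx d) (norm_nonneg d)))).1
  have h4 : inner ℝ (hess f y d - hess f x d) d ≤ w * (a * b) * ‖d‖ * ‖d‖ :=
    (abs_le.1 ((abs_real_inner_le_norm _ _).trans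
      (mul_le_mul_of_nonneg_right hHd (norm_nonneg d)))).2
  have h5 : L / 6 * ‖d‖ ^ 3 ≤ b ^ 2 / 13 / 6 * ‖d‖ ^ 3 := by gcongr
  -- The model's cubic term minus the Taylor remainder and the three error terms, in normalized
  -- units.
  have h6 : b ^ 2 / 6 * ‖d‖ ^ 3 - b ^ 2 / 13 / 6 * ‖d‖ ^ 3 - a ^ 2 / 150 * ‖d‖
      - a * b / 20 * ‖d‖ * ‖d‖ / 2 - w * (a * b) * ‖d‖ * ‖d‖ / 2
      = a ^ 3 / b * ((1 / 6 - 1 / 78) * ρ ^ 3 - ρ / 150 - ρ ^ 2 / 40 - w * ρ ^ 2 / 2) := by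
    rw [hr]; field_simp; ring
  have h7 := mul_le_mul_of_nonneg_left (cubic_progress hρ0 hw0 hcond)
    (by positivity : 0 ≤ a ^ 3 / b)
  rw [← h6] at h7
  rw [inner_sub_left] at h2 h3 h4
  simp only [model, add_sub_cancel_left]
  linarith

/-! ### One pass of the inner procedure -/

/-- The accumulated progress of the inner procedure that started at `x` and has arrived at `y`
after `t` steps, none of which found an approximate stationary point.  Here `ε = a²` and
`σ = b²`, and `S` stands for the sum of the cubes of the normalized step lengths. -/
def InnerProgress {n : ℕ} (f : E n → ℝ) (ψ : E n → EReal) (m : ℕ) (a b : ℝ) (x : E n) (t : ℕ)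
    (y : E n) : Prop :=
  ∃ S : ℝ, 0 ≤ S ∧ (‖y - x‖ * b / a) ^ 3 ≤ (t : ℝ) ^ 2 * S ∧
    a ^ 3 / b * (t / 384 + (1 / 20 - 100 * ((t : ℝ) / (13 * m)) ^ 3) * S)
      ≤ objReal f ψ x - objReal f ψ y

lemma InnerProgress.zero {n : ℕ} (f : E n → ℝ) (ψ : E n → EReal) (m : ℕ) (a b : ℝ) (x : E n) :
    InnerProgress f ψ m a b x 0 x := ⟨0, le_rfl, by simp, by simp⟩

/-- For `t ≤ m` the coefficient of `S` is nonnegative because `100 / 13³ < 1/20`; this is why `σ`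
must be at least `13 L m`. -/
lemma InnerProgress.le {n : ℕ} {f : E n → ℝ} {ψ : E n → EReal} {m : ℕ} {a b : ℝ} {x y : E n}
    {t : ℕ} (h : InnerProgress f ψ m a b x t y) (ha : 0 < a) (hb : 0 < b) (hm : 0 < m)
    (ht : t ≤ m) : a ^ 3 / b * (t / 384) ≤ objReal f ψ x - objReal f ψ y := by
  obtain ⟨S, hS, -, h⟩ := h
  refine le_trans ?_ h
  have hm' : (0 : ℝ) < m := by exact_mod_cast hm
  have h1 : (t : ℝ) / (13 * m) ≤ 1 / 13 := by
    rw [div_le_div_iff₀ (by positivity) (by norm_num)]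
    have : (t : ℝ) ≤ m := by exact_mod_cast ht
    linarith
  have h2 : ((t : ℝ) / (13 * m)) ^ 3 ≤ (1 / 13) ^ 3 := by gcongr
  have h3 : 0 ≤ (1 / 20 - 100 * ((t : ℝ) / (13 * m)) ^ 3) * S :=
    mul_nonneg (by norm_num at h2; linarith) hS
  gcongr
  linarith

lemma InnerProgress.succ {n : ℕ} {f : E n → ℝ} {ψ : E n → EReal} {L a b : ℝ} {x y y' g v : E n}
    {B : Matrix (Fin n) (Fin n) ℝ} {m t : ℕ} (h : InnerProgress f ψ m a b x t y)
    (hf : ContDiff ℝ 2 f)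
    (hL : ∀ x y, ‖hess f y - hess f x‖ ≤ L * ‖y - x‖) (hL0 : 0 ≤ L) (hψ : ∀ x, ψ x ≠ ⊥)
    (ha : 0 < a) (hb : 0 < b) (hm : 0 < m) (hLb : 13 * L * m ≤ b ^ 2)
    (hB : ∀ u v : E n, inner ℝ (Matrix.toEuclideanCLM (𝕜 := ℝ) B u) v
      = inner ℝ (Matrix.toEuclideanCLM (𝕜 := ℝ) B v) u)
    (hBx : ∀ d, ‖Matrix.toEuclideanCLM (𝕜 := ℝ) B d - hess f x d‖ ≤ a * b / 20 * ‖d‖)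
    (hg : ‖g - gradient f y‖ ≤ a ^ 2 / 150)
    (hs : InexactStep f ψ g B (b ^ 2) y y' v) (hy : y ∈ effDom ψ)
    (hv : a ^ 2 < ‖gradient f y' + v‖) : InnerProgress f ψ m a b x (t + 1) y' := by
  obtain ⟨S, hS, hP, hD⟩ := h
  have hm1 : (1 : ℝ) ≤ m := by exact_mod_cast hm
  have hLb' : 13 * L ≤ b ^ 2 := le_trans (le_mul_of_one_le_right (by positivity) hm1) hLb
  have hstep := hs.progress hf hL hL0 hψ ha hb hLb' hB hBx hg hy hv
  obtain ⟨ρ, hρ⟩ : ∃ ρ, ρ = ‖y' - y‖ * b / a := ⟨_, rfl⟩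
  obtain ⟨P, hPe⟩ : ∃ P, P = ‖y - x‖ * b / a := ⟨_, rfl⟩
  have hρ0 : 0 ≤ ρ := by rw [hρ]; positivity
  have hP0 : 0 ≤ P := by rw [hPe]; positivity
  have hw : L * ‖y - x‖ / (a * b) ≤ P / (13 * m) := by
    rw [hPe, div_div, div_le_div_iff₀ (by positivity) (by positivity)]
    nlinarith [mul_le_mul_of_nonneg_left hLb (by positivity : 0 ≤ ‖y - x‖ * a)]
  have hw3 : (L * ‖y - x‖ / (a * b)) ^ 3 ≤ t ^ 2 * S * (1 / (13 * m)) ^ 3 := by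
    calc (L * ‖y - x‖ / (a * b)) ^ 3 ≤ (P / (13 * m)) ^ 3 := by gcongr
      _ = P ^ 3 * (1 / (13 * m)) ^ 3 := by ring
      _ ≤ _ := by rw [hPe]; gcongr
  rw [← hρ] at hstep
  rw [← hPe] at hP
  refine ⟨S + ρ ^ 3, by positivity, ?_, ?_⟩
  · have h1 : ‖y' - x‖ * b / a ≤ P + ρ := by
      rw [hPe, hρ, ← add_div, ← add_mul]
      have : ‖y' - x‖ ≤ ‖y - x‖ + ‖y' - y‖ := by
        rw [add_comm]; exact norm_sub_le_norm_sub_add_norm_sub y' y x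
      gcongr
    push_cast
    exact (pow_le_pow_left₀ (by positivity) h1 3).trans
      (add_pow_three_le hP0 hρ0 (Nat.cast_nonneg t) hS hP)
  · have hU : 0 ≤ a ^ 3 / b := by positivity
    have h1 : ((t + 1 : ℕ) : ℝ) / 384
          + (1 / 20 - 100 * (((t + 1 : ℕ) : ℝ) / (13 * m)) ^ 3) * (S + ρ ^ 3)
        ≤ (t / 384 + (1 / 20 - 100 * ((t : ℝ) / (13 * m)) ^ 3) * S)
          + (1 / 384 + ρ ^ 3 / 20 - 100 * (L * ‖y - x‖ / (a * b)) ^ 3) := by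
      -- The new drift penalty is at most `100 t² S q`, and `t³ + t² ≤ (t + 1)³` absorbs it into the
      -- coefficient of `S`.
      obtain ⟨q, hq⟩ : ∃ q : ℝ, q = (1 / (13 * m)) ^ 3 := ⟨_, rfl⟩
      have hq0 : 0 ≤ q := by rw [hq]; positivity
      rw [← hq] at hw3
      have h2 : ((t : ℝ) / (13 * m)) ^ 3 = t ^ 3 * q := by rw [hq]; ring
      have h3 : (((t + 1 : ℕ) : ℝ) / (13 * m)) ^ 3 = (t + 1) ^ 3 * q := by
        rw [hq]; push_cast; ring
      rw [h2, h3]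
      push_cast
      have h4 : 0 ≤ ((t : ℝ) + 1) ^ 3 * q * ρ ^ 3 := by positivity
      have h5 : 0 ≤ (2 * (t : ℝ) ^ 2 + 3 * t + 1) * (q * S) := by positivity
      nlinarith
    have h2 := mul_le_mul_of_nonneg_left h1 hU
    rw [mul_add] at h2
    linarith

/-! ### Parameters -/

/-- The lower bound feeds the drift estimate, the upper one the constant `28 = 2 · 14` in
`outerDecrease`. -/
lemma sigma_const_bounds : 13 ≤ 2 ^ 4 * (2 / 3 : ℝ) ^ (1 / 3 : ℝ) ∧
    2 ^ 4 * (2 / 3 : ℝ) ^ (1 / 3 : ℝ) ≤ 14 := by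
  have h : ((2 / 3 : ℝ) ^ (1 / 3 : ℝ)) ^ 3 = 2 / 3 := by
    rw [← Real.rpow_natCast, ← Real.rpow_mul (by norm_num)]
    norm_num
  have h0 : 0 ≤ (2 / 3 : ℝ) ^ (1 / 3 : ℝ) := by positivity
  constructor
  · have : (13 / 16 : ℝ) ≤ (2 / 3 : ℝ) ^ (1 / 3 : ℝ) := by
      refine le_of_pow_le_pow_left₀ three_ne_zero h0 ?_
      rw [h]; norm_num
    linarith
  · have : (2 / 3 : ℝ) ^ (1 / 3 : ℝ) ≤ 14 / 16 := by
      refine le_of_pow_le_pow_left₀ three_ne_zero (by norm_num) ?_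
      rw [h]; norm_num
    linarith

lemma le_sigma {m : ℕ} {τ : ℝ} {l : ℕ} (hτ : 0 ≤ τ) : 13 * (2 ^ l * τ) * m ≤ sigma m τ l := by
  unfold sigma
  have := sigma_const_bounds.1
  gcongr

lemma sigma_le {m : ℕ} {τ : ℝ} {l : ℕ} (hτ : 0 ≤ τ) : sigma m τ l ≤ 14 * (2 ^ l * τ) * m := by
  unfold sigma
  have := sigma_const_bounds.2
  gcongr

lemma sigma_pos {m : ℕ} {τ : ℝ} {l : ℕ} (hm : 0 < m) (hτ : 0 < τ) : 0 < sigma m τ l := by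
  have hm' : (0 : ℝ) < m := by exact_mod_cast hm
  exact lt_of_lt_of_le (by positivity) (le_sigma hτ.le)

lemma rpow_three_halves_sq {a : ℝ} (ha : 0 ≤ a) : (a ^ 2) ^ (3 / 2 : ℝ) = a ^ 3 := by
  rw [← Real.rpow_natCast, ← Real.rpow_mul ha, ← Real.rpow_natCast]
  norm_num

lemma stepHess_pos {n m : ℕ} {ε τ : ℝ} {l : ℕ} (hn : 0 < n) (hm : 0 < m) (hε : 0 < ε)
    (hτ : 0 < τ) : 0 < stepHess n m ε τ l := by
  have := sigma_pos (l := l) hm hτ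
  have hn' : (0 : ℝ) < n := by exact_mod_cast hn
  unfold stepHess
  positivity

lemma stepGrad_pos {n m : ℕ} {ε σ : ℝ} (hn : 0 < n) (hm : 0 < m) (hε : 0 < ε) (hσ : 0 < σ) :
    0 < stepGrad n m ε σ := by
  have hn' : (0 : ℝ) < n := by exact_mod_cast hn
  have hm' : (0 : ℝ) < m := by exact_mod_cast hm
  unfold stepGrad
  positivity

lemma stepHess_error_le {n m : ℕ} {L a b τ : ℝ} {l : ℕ} (hn : 0 < n) (ha : 0 < a) (hb : 0 < b)
    (hτ : 0 < τ) (hσ : sigma m τ l = b ^ 2) (hLτ : L ≤ 2 ^ l * τ) (hm : 0 < m) :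
    5 / 3 * (n * L * stepHess n m (a ^ 2) τ l) ≤ a * b / 20 := by
  have hn' : (0 : ℝ) < n := by exact_mod_cast hn
  have hh := stepHess_pos (l := l) hn hm (pow_pos ha 2) hτ
  have h3 : stepHess n m (a ^ 2) τ l ^ 3
      = (3 ^ 4 * b ^ 3 * a ^ 3) / (2 ^ 14 * 192 * (n : ℝ) ^ 3 * (2 ^ l * τ) ^ 3) := by
    unfold stepHess
    rw [hσ, rpow_three_halves_sq hb.le, rpow_three_halves_sq ha.le, ← Real.rpow_natCast,
      ← Real.rpow_mul (by positivity)]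
    norm_num
  -- `3/100` is `1/20` divided by `5/3`; after cubing it remains to check `3⁴ / (2¹⁴ · 192) ≤
  -- (3/100)³`.
  have h1 : n * (2 ^ l * τ) * stepHess n m (a ^ 2) τ l ≤ 3 / 100 * (a * b) := by
    refine le_of_pow_le_pow_left₀ three_ne_zero (by positivity) ?_
    rw [mul_pow, h3, mul_pow (n : ℝ), mul_pow (3 / 100), mul_pow a b]
    have h4 : (n : ℝ) ^ 3 * (2 ^ l * τ) ^ 3 *
        (3 ^ 4 * b ^ 3 * a ^ 3 / (2 ^ 14 * 192 * (n : ℝ) ^ 3 * (2 ^ l * τ) ^ 3))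
        = 3 ^ 4 / (2 ^ 14 * 192) * (a ^ 3 * b ^ 3) := by
      field_simp
    rw [h4]
    gcongr
    norm_num
  have h2 : n * L * stepHess n m (a ^ 2) τ l ≤ n * (2 ^ l * τ) * stepHess n m (a ^ 2) τ l := by
    gcongr
  linarith

lemma stepGrad_error_le {n m : ℕ} {L a b : ℝ} (hn : 0 < n) (hm : 0 < m) (ha : 0 < a) (hb : 0 < b)
    (hL0 : 0 ≤ L) (hLb : 13 * L * m ≤ b ^ 2) :
    (n : ℝ) ^ (1 / 2 : ℝ) * (L / 6 * stepGrad n m (a ^ 2) (b ^ 2) ^ 2) ≤ a ^ 2 / 150 := by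
  have hn' : (0 : ℝ) < n := by exact_mod_cast hn
  have hm' : (0 : ℝ) < m := by exact_mod_cast hm
  have hs : 0 < (n : ℝ) ^ (1 / 2 : ℝ) := by positivity
  have h1 : (1 / (3 : ℝ) ^ (1 / 3 : ℝ)) ^ 2 ≤ 1 / 2 := by
    have h2 : ((3 : ℝ) ^ (1 / 3 : ℝ)) ^ 3 = 3 := by
      rw [← Real.rpow_natCast, ← Real.rpow_mul (by norm_num)]
      norm_num
    have h3 : 2 ≤ ((3 : ℝ) ^ (1 / 3 : ℝ)) ^ 2 := by
      refine le_of_pow_le_pow_left₀ three_ne_zero (by positivity) ?_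
      rw [← pow_mul, mul_comm, pow_mul, h2]
      norm_num
    rw [div_pow, one_pow]
    exact one_div_le_one_div_of_le two_pos h3
  have h4 : stepGrad n m (a ^ 2) (b ^ 2) ^ 2
      = (1 / (3 : ℝ) ^ (1 / 3 : ℝ)) ^ 2 * (a ^ 2 * m / (b ^ 2 * (n : ℝ) ^ (1 / 2 : ℝ))) := by
    unfold stepGrad
    rw [mul_pow]
    congr 1
    rw [← Real.sqrt_eq_rpow _, Real.sq_sqrt (by positivity)]
  rw [h4]
  calc _ ≤ (n : ℝ) ^ (1 / 2 : ℝ) * (L / 6 *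
        (1 / 2 * (a ^ 2 * m / (b ^ 2 * (n : ℝ) ^ (1 / 2 : ℝ))))) := by gcongr
    _ = (13 * L * m) * a ^ 2 / (156 * b ^ 2) := by field_simp; ring
    _ ≤ b ^ 2 * a ^ 2 / (156 * b ^ 2) := by gcongr
    _ = a ^ 2 / 156 := by field_simp
    _ ≤ a ^ 2 / 150 := by gcongr; norm_num

/-! ### Invariants of a run -/

/-- The outer iterate `x_k`. -/
def Phase.base {n : ℕ} : Phase n → E n
  | .hessian x _ _ => x
  | .cubic x _ _ _ _ _ => x
  | .check x _ _ _ _ _ _ => x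

/-- The outer parameter `τ_k`. -/
def Phase.tau {n : ℕ} : Phase n → ℝ
  | .hessian _ τ _ => τ
  | .cubic _ τ _ _ _ _ => τ
  | .check _ τ _ _ _ _ _ => τ

/-- The index `ℓ` of the adaptive search. -/
def Phase.idx {n : ℕ} : Phase n → ℕ
  | .hessian _ _ l => l
  | .cubic _ _ l _ _ _ => l
  | .check _ _ l _ _ _ _ => l

/-- The number of evaluations made since the last restart of the inner procedure. -/
def Phase.cost {n : ℕ} : Phase n → ℕ
  | .hessian _ _ _ => 0
  | .cubic _ _ _ _ t _ => 1 + 3 * n ^ 2 + t * (2 * n + 1)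
  | .check _ _ _ _ t _ _ => 1 + 3 * n ^ 2 + t * (2 * n + 1) + 2 * n

/-- What is known about the current pass of the inner procedure. -/
def Phase.InnerInv {n : ℕ} (f : E n → ℝ) (ψ : E n → EReal) (L ε : ℝ) : Phase n → Prop
  | .hessian _ _ _ => True
  | .cubic x τ l B t y => t ≤ n ∧ y ∈ effDom ψ ∧ B = fdHess f x (stepHess n n ε τ l) ∧
      ε ^ (3 / 2 : ℝ) / (384 * sigma n τ l ^ (1 / 2 : ℝ)) * t ≤ objReal f ψ x - objReal f ψ y ∧
      (L ≤ 2 ^ l * τ → InnerProgress f ψ n √ε √(sigma n τ l) x t y)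
  | .check x τ l B t y v => t < n ∧ v ∈ subdiff ψ y ∧ B = fdHess f x (stepHess n n ε τ l) ∧
      (L ≤ 2 ^ l * τ → ε < ‖gradient f y + v‖ →
        InnerProgress f ψ n √ε √(sigma n τ l) x (t + 1) y)

/-- A lower bound for the decrease of the objective in one outer iteration, when
`2^ℓ τ_k ≤ 2 M` throughout. -/
noncomputable def outerDecrease (n : ℕ) (ε M : ℝ) : ℝ :=
  ε ^ (3 / 2 : ℝ) / (384 * (28 * M * n) ^ (1 / 2 : ℝ)) * n

/-- What is known after `K` completed outer iterations and `J` restarts. -/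
structure OuterInv {n : ℕ} (f : E n → ℝ) (ψ : E n → EReal) (ε τ₀ M : ℝ) (x₀ : E n) (K J : ℕ)
    (x : E n) (τ : ℝ) (l : ℕ) : Prop where
  mem : x ∈ effDom ψ
  le_tau : τ₀ ≤ τ
  tau_le : τ ≤ M
  search_le : 2 ^ l * τ ≤ 2 * M
  decrease : K * outerDecrease n ε M ≤ objReal f ψ x₀ - objReal f ψ x
  restarts : τ₀ * 2 ^ J ≤ 2 ^ K * (2 ^ l * τ)

/-- The invariant of the configurations of a run that has not found an approximate stationary
point yet. -/
def Inv {n : ℕ} (f : E n → ℝ) (ψ : E n → EReal) (L ε τ₀ : ℝ) (x₀ : E n) (c : Config n) : Prop :=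
  c.phase.InnerInv f ψ L ε ∧ ∃ K J : ℕ,
    OuterInv f ψ ε τ₀ (max τ₀ L) x₀ K J c.phase.base c.phase.tau c.phase.idx ∧
    c.evals ≤ 7 * n ^ 2 * (K + J) + c.phase.cost

lemma length_gradQueries {n : ℕ} (x : E n) (h : ℝ) : (gradQueries x h).length = 2 * n := by
  simp [gradQueries, List.length_flatMap, mul_comm]

lemma length_hessQueries {n : ℕ} (x : E n) (h : ℝ) :
    (hessQueries x h).length = 1 + 3 * n ^ 2 := by
  simp [hessQueries, List.length_flatMap]
  ring

lemma test_iff {n : ℕ} {f : E n → ℝ} {ψ : E n → EReal} (hψ : ∀ x, ψ x ≠ ⊥) {x y : E n}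
    (hx : x ∈ effDom ψ) (hy : y ∈ effDom ψ) (c : ℝ) :
    (c : EReal) ≤ obj f ψ x - obj f ψ y ↔ c ≤ objReal f ψ x - objReal f ψ y := by
  rw [obj_eq_coe hψ hx, obj_eq_coe hψ hy, ← EReal.coe_sub, EReal.coe_le_coe_iff]

lemma Inv.init {n : ℕ} {f : E n → ℝ} {ψ : E n → EReal} {L ε τ₀ : ℝ} {x₀ : E n} (hτ₀ : 0 < τ₀)
    (hx₀ : x₀ ∈ effDom ψ) : Inv f ψ L ε τ₀ x₀ ⟨.hessian x₀ τ₀ 0, []⟩ := by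
  have h : τ₀ ≤ max τ₀ L := le_max_left _ _
  refine ⟨trivial, 0, 0, ⟨hx₀, le_rfl, h, ?_, ?_, ?_⟩, ?_⟩
  · simp only [Phase.idx, Phase.tau, pow_zero]; linarith
  · simp [Phase.base]
  · simp [Phase.tau, Phase.idx]
  · simp [Config.evals]

lemma unit_eq {ε σ : ℝ} (hε : 0 ≤ ε) (k : ℝ) :
    ε ^ (3 / 2 : ℝ) / (384 * σ ^ (1 / 2 : ℝ)) * k = √ε ^ 3 / √σ * (k / 384) := by
  have h1 : ε ^ (3 / 2 : ℝ) = √ε ^ 3 := by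
    conv_lhs => rw [← Real.sq_sqrt hε]
    exact rpow_three_halves_sq (Real.sqrt_nonneg ε)
  rw [h1, ← Real.sqrt_eq_rpow, div_mul_div_comm, mul_comm √σ, div_mul_eq_mul_div]

lemma outerDecrease_le {n : ℕ} {ε τ M : ℝ} {l : ℕ} (hn : 0 < n) (hε : 0 < ε) (hτ : 0 < τ)
    (hM : 2 ^ l * τ ≤ 2 * M) :
    outerDecrease n ε M ≤ ε ^ (3 / 2 : ℝ) / (384 * sigma n τ l ^ (1 / 2 : ℝ)) * n := by
  have hσ := sigma_pos (l := l) hn hτ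
  have h1 : sigma n τ l ≤ 28 * M * n := by
    refine (sigma_le hτ.le).trans (mul_le_mul_of_nonneg_right ?_ (Nat.cast_nonneg n))
    linarith
  unfold outerDecrease
  gcongr

/-- The hypothesis `¬ Found` concerns only the configuration being left, so the invariant, and with
it the evaluation bound, also holds at the first configuration that is `Found`. -/
lemma Inv.step {n : ℕ} {f : E n → ℝ} {ψ : E n → EReal} {L ε τ₀ : ℝ} {x₀ : E n} {c c' : Config n}
    (hn : 0 < n) (hf : ContDiff ℝ 2 f) (hψ : ∀ x, ψ x ≠ ⊥) (hL0 : 0 ≤ L)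
    (hL : ∀ x y, ‖hess f y - hess f x‖ ≤ L * ‖y - x‖) (hτ₀ : 0 < τ₀) (hε : 0 < ε)
    (h : Inv f ψ L ε τ₀ x₀ c) (hnf : ¬ Found f ψ ε c) (hstep : Step f ψ n ε τ₀ c c') :
    Inv f ψ L ε τ₀ x₀ c' := by
  obtain ⟨hin, K, J, hout, hev⟩ := h
  cases hstep with
  | approxHess x τ l q =>
    refine ⟨⟨Nat.zero_le n, hout.mem, rfl, by simp, fun _ => .zero f ψ n _ _ x⟩, K, J, hout, ?_⟩
    simp only [Config.evals, Phase.cost, List.length_append, length_hessQueries] at hev ⊢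
    omega
  | success x τ l B y q =>
    obtain ⟨-, hy, -, hdec, -⟩ := hin
    obtain ⟨hx, h1, h2, h3, h4, h5⟩ := hout
    simp only [Phase.base, Phase.tau, Phase.idx] at hx h1 h2 h3 h4 h5
    have hτ : 0 < τ := hτ₀.trans_le h1
    have hz : (2 : ℝ) ^ ((l : ℤ) - 1) * τ = 2 ^ l * τ / 2 := by
      rw [zpow_sub₀ two_ne_zero, zpow_natCast, zpow_one]; ring
    have h6 : max τ₀ ((2 : ℝ) ^ ((l : ℤ) - 1) * τ) ≤ max τ₀ L :=
      max_le (le_max_left _ _) (by rw [hz]; linarith)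
    -- The search index returns to `0`, so `2^ℓ τ` is at most halved; the extra factor `2 ^ (K + 1)`
    -- in `restarts` compensates.
    have h7 : 2 ^ l * τ / 2 ≤ max τ₀ ((2 : ℝ) ^ ((l : ℤ) - 1) * τ) := hz ▸ le_max_right _ _
    have h8 := outerDecrease_le hn hε hτ h3
    refine ⟨trivial, K + 1, J, ⟨hy, le_max_left _ _, h6, ?_, ?_, ?_⟩, ?_⟩ <;>
      simp only [Phase.base, Phase.tau, Phase.idx]
    · have := hτ₀.trans_le (le_max_left τ₀ L)
      linarith
    · push_cast
      linarith
    · refine h5.trans ?_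
      rw [pow_succ, mul_assoc, pow_zero, one_mul]
      refine mul_le_mul_of_nonneg_left ?_ (by positivity)
      linarith
    · simp only [Config.evals, Phase.cost] at hev ⊢
      nlinarith
  | newton x τ l B t y y' v q ht hstep =>
    obtain ⟨htn, hy, hB, -, hprog⟩ := hin
    refine ⟨⟨lt_of_le_of_ne htn ht, hstep.subgrad, hB, fun hLτ hv => ?_⟩, K, J, hout, ?_⟩
    · have hτ : 0 < τ := hτ₀.trans_le hout.le_tau
      have hσ := sigma_pos (l := l) hn hτ
      have hε2 := Real.sq_sqrt hε.le
      have hσ2 := Real.sq_sqrt hσ.le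
      have hLb : 13 * L * n ≤ √(sigma n τ l) ^ 2 := by
        rw [hσ2]
        refine le_trans ?_ (le_sigma hτ.le)
        gcongr
      have hsg : 0 < stepGrad n n ε (sigma n τ l) := stepGrad_pos hn hn hε hσ
      have hsh : 0 < stepHess n n ε τ l := stepHess_pos hn hn hε hτ
      refine (hprog hLτ).succ (g := fdGrad f y (stepGrad n n ε (sigma n τ l))) (B := B) (v := v)
        hf hL hL0 hψ (Real.sqrt_pos.2 hε) (Real.sqrt_pos.2 hσ) hn hLb ?_ ?_ ?_ ?_ hy ?_
      · rw [hB]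
        exact inner_fdHess_symm f x _
      · intro d
        rw [hB]
        refine (norm_fdHess_sub_apply_le hf hL hL0 x hsh d).trans ?_
        gcongr
        have := stepHess_error_le hn (Real.sqrt_pos.2 hε) (Real.sqrt_pos.2 hσ) hτ hσ2.symm hLτ hn
        rwa [hε2] at this
      · refine (norm_fdGrad_sub_le hf hL hL0 y hsg).trans ?_
        have := stepGrad_error_le hn hn (Real.sqrt_pos.2 hε) (Real.sqrt_pos.2 hσ) hL0 hLb
        rw [hσ2, hε2] at this
        rwa [hε2]
      · rwa [hσ2]
      · rwa [hε2]
    · simp only [Config.evals, Phase.cost, List.length_append, length_gradQueries] at hev ⊢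
      omega
  | accept x τ l B t y v q htest =>
    obtain ⟨htn, hv, hB, hprog⟩ := hin
    have hnf' : ε < ‖gradient f y + v‖ := by
      by_contra hcon
      exact hnf ⟨x, τ, l, B, t, y, v, rfl, hv, not_lt.1 hcon⟩
    rw [test_iff hψ (show x ∈ effDom ψ from hout.mem) hv.1] at htest
    refine ⟨⟨htn, hv.1, hB, by exact_mod_cast htest, fun hLτ => hprog hLτ hnf'⟩, K, J, hout, ?_⟩
    simp only [Config.evals, Phase.cost, List.length_append, List.length_singleton] at hev ⊢
    linarith
  | halt x τ l B t y v q htest =>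
    obtain ⟨htn, hv, hB, hprog⟩ := hin
    have hnf' : ε < ‖gradient f y + v‖ := by
      by_contra hcon
      exact hnf ⟨x, τ, l, B, t, y, v, rfl, hv, not_lt.1 hcon⟩
    rw [test_iff hψ (show x ∈ effDom ψ from hout.mem) hv.1] at htest
    obtain ⟨hx, h1, h2, h3, h4, h5⟩ := hout
    simp only [Phase.base, Phase.tau, Phase.idx] at hx h1 h2 h3 h4 h5
    have hτ : 0 < τ := hτ₀.trans_le h1
    have hσ := sigma_pos (l := l) hn hτ
    -- Otherwise the accumulated progress would have passed the test.
    have hlt : 2 ^ l * τ < L := by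
      by_contra hcon
      refine htest ?_
      rw [unit_eq hε.le]
      exact_mod_cast (hprog (not_lt.1 hcon) hnf').le (Real.sqrt_pos.2 hε) (Real.sqrt_pos.2 hσ) hn htn
    refine ⟨trivial, K, J + 1, ⟨hx, h1, h2, ?_, h4, ?_⟩, ?_⟩ <;>
      simp only [Phase.tau, Phase.idx]
    · have := le_max_right τ₀ L
      rw [pow_succ]
      linarith
    · rw [pow_succ, pow_succ]
      linarith
    · simp only [Config.evals, Phase.cost, List.length_append, List.length_singleton] at hev ⊢
      have : (t + 1) * (2 * n + 1) ≤ n * (2 * n + 1) := Nat.mul_le_mul_right _ htn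
      nlinarith

/-- Only `success` evaluates nothing, and it ends in a `hessian` phase, from which it cannot recur
at once. The sharper bound outside `hessian` phases carries the induction. -/
lemma le_two_mul_evals {n : ℕ} {f : E n → ℝ} {ψ : E n → EReal} {ε τ₀ : ℝ} {x₀ : E n}
    {r : ℕ → Config n} (hn : 0 < n) (hr : IsRun f ψ n ε τ₀ x₀ r) (i : ℕ) :
    i ≤ 2 * (r i).evals + 1 ∧ ((∀ x τ l, (r i).phase ≠ .hessian x τ l) → i ≤ 2 * (r i).evals) := by
  induction i with
  | zero => simp
  | succ i ih =>
    have hs := hr.2 i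
    generalize r i = c at hs ih
    generalize r (i + 1) = c' at hs
    cases hs <;> simp [Config.evals, length_gradQueries, length_hessQueries] at ih ⊢ <;> omega

lemma Inv.evals_le {n : ℕ} {f : E n → ℝ} {ψ : E n → EReal} {L ε τ₀ o : ℝ} {x₀ : E n}
    {c : Config n} (hn : 0 < n) (hτ₀ : 0 < τ₀) (hε : 0 < ε)
    (ho : ∀ x ∈ effDom ψ, o ≤ objReal f ψ x) (h : Inv f ψ L ε τ₀ x₀ c) :
    (c.evals : ℝ) ≤ 30000 * ((n : ℝ) ^ (3 / 2 : ℝ) * max τ₀ L ^ (1 / 2 : ℝ) *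
      (objReal f ψ x₀ - o) * ε ^ (-(3 / 2) : ℝ)
        + (n : ℝ) ^ 2 * (1 + Real.logb 2 (max τ₀ L / τ₀))) := by
  obtain ⟨hin, K, J, hout, hev⟩ := h
  have hM : τ₀ ≤ max τ₀ L := le_max_left _ _
  obtain ⟨M, hMe⟩ : ∃ M, M = max τ₀ L := ⟨_, rfl⟩
  rw [← hMe] at hM hout ⊢
  have hM0 : 0 < M := hτ₀.trans_le hM
  have hn1 : (1 : ℝ) ≤ n := by exact_mod_cast hn
  have hcost : c.phase.cost ≤ 7 * n ^ 2 := by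
    generalize c.phase = p at hin
    cases p with
    | hessian x τ l => simp [Phase.cost]
    | cubic x τ l B t y =>
      have : t * (2 * n + 1) ≤ n * (2 * n + 1) := Nat.mul_le_mul_right _ hin.1
      simp only [Phase.cost]
      nlinarith
    | check x τ l B t y v =>
      have : (t + 1) * (2 * n + 1) ≤ n * (2 * n + 1) := Nat.mul_le_mul_right _ hin.1
      simp only [Phase.cost]
      nlinarith
  have hev' : (c.evals : ℝ) ≤ 7 * n ^ 2 * (K + J + 1) := by
    have : c.evals ≤ 7 * n ^ 2 * (K + J + 1) := by linarith
    exact_mod_cast this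
  -- Compare the two bounds on `2^ℓ τ` and take logarithms.
  have hJ : (J : ℝ) ≤ K + 1 + Real.logb 2 (M / τ₀) := by
    have h1 : τ₀ * 2 ^ J ≤ 2 ^ K * (2 * M) :=
      hout.restarts.trans (mul_le_mul_of_nonneg_left hout.search_le (by positivity))
    have h2 : (2 : ℝ) ^ J ≤ 2 ^ (K + 1) * (M / τ₀) := by
      rw [pow_succ, ← mul_div_assoc, le_div_iff₀ hτ₀]
      linarith
    have h3 := Real.logb_le_logb_of_le one_lt_two (by positivity) h2
    rw [Real.logb_mul (by positivity) (by positivity), Real.logb_pow, Real.logb_pow,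
      Real.logb_self_eq_one one_lt_two] at h3
    push_cast at h3
    linarith
  have hlog : 0 ≤ Real.logb 2 (M / τ₀) :=
    Real.logb_nonneg one_lt_two ((one_le_div hτ₀).2 hM)
  -- Replacing `J` by `K` in `7 n² (K + J + 1)` produces the factor `14`; then `14 · 384 · √28 ≤
  -- 30000`.
  have hK : 14 * (n : ℝ) ^ 2 * K ≤ 30000 * ((n : ℝ) ^ (3 / 2 : ℝ) * M ^ (1 / 2 : ℝ) *
      (objReal f ψ x₀ - o) * ε ^ (-(3 / 2) : ℝ)) := by
    have h1 : K * outerDecrease n ε M ≤ objReal f ψ x₀ - o :=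
      hout.decrease.trans (by linarith [ho _ hout.mem])
    have hΔ : 0 ≤ objReal f ψ x₀ - o :=
      le_trans (by unfold outerDecrease; positivity) h1
    obtain ⟨u, hu⟩ : ∃ u, u = ε ^ (3 / 2 : ℝ) := ⟨_, rfl⟩
    have hu0 : 0 < u := by rw [hu]; positivity
    have h2 : ε ^ (-(3 / 2) : ℝ) = 1 / u := by rw [Real.rpow_neg hε.le, hu, one_div]
    have h3 : (n : ℝ) ^ (3 / 2 : ℝ) = √n * n := by
      rw [show (3 / 2 : ℝ) = 1 / 2 + 1 by norm_num, Real.rpow_add (by positivity),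
        Real.rpow_one, Real.sqrt_eq_rpow]
    have h4 : (28 * M * n) ^ (1 / 2 : ℝ) = √28 * √M * √n := by
      rw [← Real.sqrt_eq_rpow, Real.sqrt_mul (by positivity), Real.sqrt_mul (by norm_num)]
    have h5 : √28 ≤ 5.3 := by
      rw [Real.sqrt_le_left (by norm_num)]; norm_num
    have h6 : 0 < √M := Real.sqrt_pos.2 hM0
    have h7 : 0 < √(n : ℝ) := Real.sqrt_pos.2 (by linarith)
    have h8 : 0 < √(28 : ℝ) := Real.sqrt_pos.2 (by norm_num)
    rw [outerDecrease, h4, ← hu] at h1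
    rw [h2, h3, ← Real.sqrt_eq_rpow]
    have h9 : 14 * (n : ℝ) ^ 2 * K
        = 14 * 384 * √28 * (√n * n * √M * (1 / u))
          * (K * (u / (384 * (√28 * √M * √n)) * n)) := by
      field_simp
    rw [h9]
    calc _ ≤ 14 * 384 * 5.3 * (√n * n * √M * (1 / u)) * (objReal f ψ x₀ - o) := by gcongr
      _ ≤ 30000 * (√n * n * √M * (1 / u)) * (objReal f ψ x₀ - o) := by gcongr; norm_num
      _ = _ := by ring
  have hn2 : (0 : ℝ) ≤ n ^ 2 := by positivity
  nlinarith [mul_nonneg hn2 hlog, mul_le_mul_of_nonneg_left hJ hn2]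

/-- The square root of `n ε³ ≤ 1` is `n^(1/2) ≤ ε^(-3/2)`, which trades the surplus `n^(1/2)` of
`n²`. -/
lemma sq_le_rpow_mul {n : ℕ} {ε : ℝ} (hε : 0 < ε) (h : (n : ℝ) * ε ^ 3 ≤ 1) :
    (n : ℝ) ^ 2 ≤ (n : ℝ) ^ (3 / 2 : ℝ) * ε ^ (-(3 / 2) : ℝ) := by
  have hn : (0 : ℝ) ≤ n := Nat.cast_nonneg n
  have h1 : (n : ℝ) ^ 2 = (n : ℝ) ^ (3 / 2 : ℝ) * (n : ℝ) ^ (1 / 2 : ℝ) := by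
    rw [← Real.rpow_add_of_nonneg hn (by norm_num) (by norm_num), ← Real.rpow_natCast]
    norm_num
  have h2 : (n : ℝ) ^ (1 / 2 : ℝ) * ε ^ (3 / 2 : ℝ) ≤ 1 := by
    have := Real.rpow_le_rpow (by positivity) h (by norm_num : (0 : ℝ) ≤ 1 / 2)
    rw [Real.mul_rpow hn (by positivity), ← Real.rpow_natCast ε, ← Real.rpow_mul hε.le,
      Real.one_rpow] at this
    norm_num at this ⊢
    exact this
  rw [h1, Real.rpow_neg hε.le]
  gcongr
  rwa [← one_div, le_div_iff₀ (by positivity)]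

lemma exists_optValue_eq_coe {n : ℕ} {f : E n → ℝ} {ψ : E n → EReal} (hψ : ∀ x, ψ x ≠ ⊥)
    {x₀ : E n} (hx₀ : x₀ ∈ effDom ψ) (hb : ⊥ < optValue f ψ) :
    ∃ o : ℝ, optValue f ψ = o ∧ ∀ x ∈ effDom ψ, o ≤ objReal f ψ x := by
  have h1 : ∀ x ∈ effDom ψ, optValue f ψ ≤ (objReal f ψ x : EReal) := fun x hx => by
    rw [← obj_eq_coe hψ hx]
    exact iInf₂_le x hx
  have h2 : optValue f ψ ≠ ⊤ := ne_top_of_le_ne_top (EReal.coe_ne_top _) (h1 x₀ hx₀)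
  refine ⟨(optValue f ψ).toReal, (EReal.coe_toReal h2 hb.ne').symm, fun x hx => ?_⟩
  rw [← EReal.coe_le_coe_iff, EReal.coe_toReal h2 hb.ne']
  exact h1 x hx

end ZeroOrderCNM

theorem mainTheorem6 :
    ∃ C : ℝ, 0 < C ∧
      ∀ (n : ℕ), 1 ≤ n →
      ∀ (f : ZeroOrderCNM.E n → ℝ) (ψ : ZeroOrderCNM.E n → EReal) (L τ₀ ε : ℝ)
        (x₀ : ZeroOrderCNM.E n),
        ContDiff ℝ 2 f →
        ZeroOrderCNM.ProperClosedConvex ψ →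
        0 ≤ L →
        (∀ x y, ‖ZeroOrderCNM.hess f y - ZeroOrderCNM.hess f x‖ ≤ L * ‖y - x‖) →
        ⊥ < ZeroOrderCNM.optValue f ψ →
        0 < τ₀ → 0 < ε → x₀ ∈ ZeroOrderCNM.effDom ψ →
        ∀ r : ℕ → ZeroOrderCNM.Config n, ZeroOrderCNM.IsRun f ψ n ε τ₀ x₀ r →
          ∃ i : ℕ, ZeroOrderCNM.Found f ψ ε (r i) ∧
            ((r i).evals : ℝ) ≤
              C * ((n : ℝ) ^ (3 / 2 : ℝ) * max τ₀ L ^ (1 / 2 : ℝ) *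
                    (ZeroOrderCNM.obj f ψ x₀ - ZeroOrderCNM.optValue f ψ).toReal *
                    ε ^ (-(3 / 2) : ℝ)
                  + (n : ℝ) ^ 2 * (1 + Real.logb 2 (max τ₀ L / τ₀))) ∧
            ((n : ℝ) * ε ^ 3 ≤ 1 →
              ((r i).evals : ℝ) ≤
                C * (max τ₀ L ^ (1 / 2 : ℝ) *
                      (ZeroOrderCNM.obj f ψ x₀ - ZeroOrderCNM.optValue f ψ).toReal
                    + 1 + Real.logb 2 (max τ₀ L / τ₀)) *
                  ((n : ℝ) ^ (3 / 2 : ℝ) * ε ^ (-(3 / 2) : ℝ))) := by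
  refine ⟨30000, by norm_num, ?_⟩
  intro n hn f ψ L τ₀ ε x₀ hf hψ hL0 hL hb hτ₀ hε hx₀ r hr
  obtain ⟨o, ho, hle⟩ := ZeroOrderCNM.exists_optValue_eq_coe hψ.ne_bot hx₀ hb
  have hΔ : (ZeroOrderCNM.obj f ψ x₀ - ZeroOrderCNM.optValue f ψ).toReal
      = ZeroOrderCNM.objReal f ψ x₀ - o := by
    rw [ho, ZeroOrderCNM.obj_eq_coe hψ.ne_bot hx₀, ← EReal.coe_sub, EReal.toReal_coe]
  rw [hΔ]
  have hinv : ∀ i, (∀ j < i, ¬ ZeroOrderCNM.Found f ψ ε (r j)) →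
      ZeroOrderCNM.Inv f ψ L ε τ₀ x₀ (r i) := by
    intro i
    induction i with
    | zero => intro _; rw [hr.1]; exact .init hτ₀ hx₀
    | succ i ih =>
      intro h
      exact (ih fun j hj => h j (hj.trans i.lt_succ_self)).step hn hf hψ.ne_bot hL0 hL hτ₀ hε
        (h i i.lt_succ_self) (hr.2 i)
  have hex : ∃ i, ZeroOrderCNM.Found f ψ ε (r i) := by
    by_contra! hnone
    obtain ⟨N, hN⟩ := exists_nat_gt (30000 * ((n : ℝ) ^ (3 / 2 : ℝ) * max τ₀ L ^ (1 / 2 : ℝ) *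
      (ZeroOrderCNM.objReal f ψ x₀ - o) * ε ^ (-(3 / 2) : ℝ)
        + (n : ℝ) ^ 2 * (1 + Real.logb 2 (max τ₀ L / τ₀))))
    -- Without a stationary point the evaluation bound would hold at every index, yet at index `2 N
    -- + 2` more than `N` evaluations have been made.
    have h1 := ((hinv (2 * N + 2) fun j _ => hnone j).evals_le hn hτ₀ hε hle).trans_lt hN
    have h2 := (ZeroOrderCNM.le_two_mul_evals hn hr (2 * N + 2)).1
    have h3 : (r (2 * N + 2)).evals < N := by exact_mod_cast h1
    omega
  classical
  refine ⟨Nat.find hex, Nat.find_spec hex, ?_⟩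
  have hmain := (hinv (Nat.find hex) fun j hj => Nat.find_min hex hj).evals_le hn hτ₀ hε hle
  refine ⟨hmain, fun hnε => hmain.trans ?_⟩
  have hlog : 0 ≤ Real.logb 2 (max τ₀ L / τ₀) :=
    Real.logb_nonneg one_lt_two ((one_le_div hτ₀).2 (le_max_left _ _))
  nlinarith [mul_le_mul_of_nonneg_right (ZeroOrderCNM.sq_le_rpow_mul hε hnε)
    (by linarith : 0 ≤ 1 + Real.logb 2 (max τ₀ L / τ₀))]
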